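/- Consider a bandit problem with arms $1,\dots,K$ and an arbitrary parameter set $\Theta$. Under the parameter $\theta\in\Theta$ the rewards of arm $k$ have law $\nu_k(\theta)$ on $\mathbb R$, with mean $\mu_k(\theta)$ and sub-Gaussian with a common variance proxy $\sigma^2$; arm $k$'s reward law is determined by its mean, i.e. $\mu_k(\theta)=\mu_k(\lambda)$ implies $\nu_k(\theta)=\nu_k(\lambda)$. The functions $\mu_k$ are otherwise arbitrary. An algorithm $\pi$ chooses, possibly at random, the arm $k_t$ of round $t$ from the arms and rewards of the earlier rounds, and $\mathrm{Reg}^\pi(T,\theta)=\mathbb E_\theta\big[\sum_{t=1}^T(\max_\ell\mu_\ell(\theta)-\mu_{k_t}(\theta))\big]$ is its expected regret. It is uniformly good if $\mathrm{Reg}^\pi(T,\theta)=o(T^a)$ for all $a>0$ and all $\theta\in\Theta$. Fix $\theta^*\in\Theta$ at which the optimal arm $k^*$ is unique, and let $\Theta^*=\{\theta\in\Theta:\mu_{k^*}(\theta)=\mu_{k^*}(\theta^*)\}$. An arm $k$ is $\Theta^*$-competitive if $\mu_k(\theta)=\max_\ell\mu_\ell(\theta)$ for some $\theta\in\Theta^*$;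 let $\tilde C(\theta^*)$ be the number of such arms. Let $\Lambda(\theta^*)=\{\lambda\in\Theta^*:\mu_{k^*}(\lambda)<\max_\ell\mu_\ell(\lambda)\}$ and $$L(\theta^*)=\inf\Big\{\sum_{k}\eta(k)\big(\max_\ell\mu_\ell(\theta^*)-\mu_k(\theta^*)\big)\;:\;\eta\in[0,\infty)^K,\ \sum_{k}\eta(k)\,D\big(\nu_k(\theta^*)\,\|\,\nu_k(\lambda)\big)\ge 1\ \text{ for all }\lambda\in\Lambda(\theta^*)\Big\}\in[0,\infty],$$ where $D$ is the Kullback--Leibler divergence (with $0\cdot\infty=0$). Then: 1. For every uniformly good algorithm $\pi$, $\displaystyle\liminf_{T\to\infty}\frac{\mathrm{Reg}^\pi(T,\theta^*)}{\log T}\ge L(\theta^*)$. 2. If $\tilde C(\theta^*)=1$, then $L(\theta^*)=0$. 3. Suppose that at every $\theta\in\Theta^*$ at which $k^*$ is optimal it is the only optimal arm, and that $D(\nu_k(\theta^*)\|\nu_k(\theta))<\infty$ for all $k$ and all $\theta\in\Theta^*$. If $\tilde C(\theta^*)>1$, then $L(\theta^*)>0$. Consequently, a uniformly good algorithm with bounded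 regret $\sup_T\mathrm{Reg}^\pi(T,\theta^*)<\infty$ exists only if $\tilde C(\theta^*)=1$. -/

import Mathlib

open MeasureTheory ProbabilityTheory Filter Asymptotics InformationTheory
open scoped ENNReal NNReal

noncomputable section

namespace StructuredBandit

/-- A history of `t` rounds: the arm pulled and the reward observed in each round. -/
abbrev History (K t : ℕ) : Type := Fin t → Fin K × ℝ

/-- A (possibly randomized) bandit algorithm with `K` arms: in round `t + 1` it draws an arm from
a distribution that depends measurably on the arms and rewards of the first `t` rounds.
It has no access to the hidden parameter. -/
structure Algorithm (K : ℕ) where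
  /-- the conditional law of the next arm given the history -/
  select : (t : ℕ) → Kernel (History K t) (Fin K)
  markov : ∀ t, IsMarkovKernel (select t)

/-- The law of the first `t` rounds when the algorithm `π` plays against arms whose rewards have
the laws `ρ k`: given the past, the next arm is drawn from `π.select`, and given the past and this
arm `k`, the reward is drawn from `ρ k`. -/
def historyLaw {K : ℕ} (π : Algorithm K) (ρ : Kernel (Fin K) ℝ) :
    (t : ℕ) → Measure (History K t)
  | 0 => Measure.dirac (fun i => i.elim0)
  | t + 1 =>
      (historyLaw π ρ t ⊗ₘ (π.select t ⊗ₖ ρ.prodMkLeft (History K t))).map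
        (fun p => (Fin.snoc p.1 p.2 : History K (t + 1)))

/- In what follows `ν θ k` is the law of the reward of arm `k` under the parameter `θ : Θ`. -/
variable {K : ℕ} {Θ : Type*} (ν : Θ → Kernel (Fin K) ℝ)

/-- The mean reward `μ_k(θ)` of arm `k` under the parameter `θ`. -/
def mean (k : Fin K) (θ : Θ) : ℝ := ∫ x, x ∂(ν θ k)

/-- The largest mean reward `max_ℓ μ_ℓ(θ)`. -/
def maxMean (θ : Θ) : ℝ := ⨆ k, mean ν k θ

/-- Arm `k` is optimal under `θ`: `μ_k(θ) = max_ℓ μ_ℓ(θ)`. -/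
def IsOptimal (θ : Θ) (k : Fin K) : Prop := mean ν k θ = maxMean ν θ

/-- The expected cumulative regret of `π` after `T` rounds under the parameter `θ`. -/
def regret (π : Algorithm K) (θ : Θ) (T : ℕ) : ℝ :=
  ∫ h, ∑ t : Fin T, (maxMean ν θ - mean ν (h t).1 θ) ∂(historyLaw π (ν θ) T)

/-- `π` is uniformly good: its regret is `o(T ^ a)` for all `a > 0` and all parameters. -/
def UniformlyGood (π : Algorithm K) : Prop :=
  ∀ θ : Θ, ∀ a : ℝ, 0 < a →
    (fun T : ℕ => regret ν π θ T) =o[atTop] (fun T : ℕ => (T : ℝ) ^ a)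

/-- Arm `k` is `S`-competitive: its mean reward is the highest among all arms for some `θ ∈ S`. -/
def IsCompetitive (S : Set Θ) (k : Fin K) : Prop := ∃ θ ∈ S, IsOptimal ν θ k

/-- The set `Θ* = {θ : μ_{k*}(θ) = μ_{k*}(θ*)}`. -/
def thetaStar (θstar : Θ) (kstar : Fin K) : Set Θ :=
  {θ | mean ν kstar θ = mean ν kstar θstar}

/-- The number `C̃(θ*)` of `Θ*`-competitive arms. -/
def numCompetitive (θstar : Θ) (kstar : Fin K) : ℕ :=
  {k : Fin K | IsCompetitive ν (thetaStar ν θstar kstar) k}.ncard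

/-- The set `Λ(θ*)` of the parameters in `Θ*` under which `k*` is not optimal. -/
def confusing (θstar : Θ) (kstar : Fin K) : Set Θ :=
  {lam ∈ thetaStar ν θstar kstar | ¬ IsOptimal ν lam kstar}

/-- Feasibility of the exploration rates `η`: `∑ k, η(k) D(θ*, λ, k) ≥ 1` for all `λ ∈ Λ(θ*)`,
where `D(θ*, λ, k)` is the Kullback-Leibler divergence between the reward laws of arm `k` under
`θ*` and under `λ`. -/
def IsFeasible (θstar : Θ) (kstar : Fin K) (η : Fin K → ℝ≥0) : Prop :=
  ∀ lam ∈ confusing ν θstar kstar, 1 ≤ ∑ k, (η k : ℝ≥0∞) * klDiv (ν θstar k) (ν lam k)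

/-- The constant `L(θ*)`: the value of the problem of minimizing
`∑ k, η(k) (max_ℓ μ_ℓ(θ*) - μ_k(θ*))` over the feasible rates `η ≥ 0`. -/
def lowerBoundConst (θstar : Θ) (kstar : Fin K) : ℝ≥0∞ :=
  ⨅ (η : Fin K → ℝ≥0) (_ : IsFeasible ν θstar kstar η),
    ∑ k, (η k : ℝ≥0∞) * ENNReal.ofReal (maxMean ν θstar - mean ν k θstar)

end StructuredBandit

end

open scoped Topology

/-!
Compare `θ*` with a confusing parameter `λ`. Under `θ*` a uniformly good algorithm pulls `k*` in at
least half of the rounds with probability tending to one, while under `λ` Markov's inequality for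
the regret makes this event as rare as `T ^ (a - 1)`, for every `a > 0`. The data processing
inequality for this event shows that the laws of the histories under `θ*` and `λ` have divergence
at least `(1 - o(1)) log T`. By the chain rule this divergence is `∑ k, E[N_k(T)] D(θ*, λ, k)`,
where `N_k(T)` is the number of pulls of arm `k`, and the regret is `∑ k, E[N_k(T)] Δ_k` with `Δ_k`
the gap of arm `k` under `θ*`. Hence a limit point of `E[N_k(T)] / log T`, taken along an
ultrafilter that realizes the lower limit of the normalized regret, has that lower limit as its
cost and satisfies the constraints of `L(θ*)` at all `λ` with finite divergences. Adding `ε > 0` to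
the rates takes care of the other `λ`, and `ε` tends to zero.

For the positivity of `L(θ*)`, a single confusing `λ` with finite divergences suffices: as `k*` has
the same reward law under `θ*` and `λ`, the divergences are dominated by a multiple of the gaps.
-/

namespace StructuredBandit

section KullbackLeibler

variable {α β : Type*} {mα : MeasurableSpace α} {mβ : MeasurableSpace β}

lemma klDiv_map_of_leftInverse {f : α → β} {g : β → α} (hf : Measurable f) (hg : Measurable g)
    (hgf : Function.LeftInverse g f) (μ ν : Measure α) [IsFiniteMeasure μ] [IsFiniteMeasure ν] :
    klDiv (μ.map f) (ν.map f) = klDiv μ ν := by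
  refine le_antisymm (klDiv_map_le μ ν hf) ?_
  simpa only [Measure.map_map hg hf, hgf.id, Measure.map_id]
    using klDiv_map_le (μ.map f) (ν.map f) hg

lemma rnDeriv_compProd_right [MeasurableSpace.CountableOrCountablyGenerated α β]
    {μ : Measure α} [SFinite μ] {κ η : Kernel α β} [IsFiniteKernel κ] [IsFiniteKernel η]
    [SigmaFinite (μ ⊗ₘ η)] (hκη : ∀ᵐ a ∂μ, κ a ≪ η a) :
    (μ ⊗ₘ κ).rnDeriv (μ ⊗ₘ η) =ᵐ[μ ⊗ₘ η] fun p => Kernel.rnDeriv κ η p.1 p.2 := by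
  have hmeas : Measurable fun p : α × β => Kernel.rnDeriv κ η p.1 p.2 :=
    Kernel.measurable_rnDeriv κ η
  have hκ : η.withDensity (Kernel.rnDeriv κ η) =ᵐ[μ] κ :=
    hκη.mono fun a ha => Kernel.withDensity_rnDeriv_eq ha
  rw [← Measure.compProd_congr hκ, Measure.compProd_withDensity hmeas]
  exact Measure.rnDeriv_withDensity _ hmeas

lemma klDiv_compProd_right_eq_lintegral [MeasurableSpace.CountableOrCountablyGenerated α β]
    (μ : Measure α) [IsFiniteMeasure μ] (κ η : Kernel α β) [IsFiniteKernel κ] [IsFiniteKernel η] :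
    klDiv (μ ⊗ₘ κ) (μ ⊗ₘ η) = ∫⁻ a, klDiv (κ a) (η a) ∂μ := by
  by_cases hκη : ∀ᵐ a ∂μ, κ a ≪ η a
  · calc klDiv (μ ⊗ₘ κ) (μ ⊗ₘ η)
        = ∫⁻ p, ENNReal.ofReal (klFun (Kernel.rnDeriv κ η p.1 p.2).toReal) ∂(μ ⊗ₘ η) := by
          rw [klDiv_eq_lintegral_klFun_of_ac (.compProd_right hκη)]
          exact lintegral_congr_ae ((rnDeriv_compProd_right hκη).mono fun p hp => by simp only [hp])
      _ = ∫⁻ a, ∫⁻ b, ENNReal.ofReal (klFun (Kernel.rnDeriv κ η a b).toReal) ∂(η a) ∂μ :=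
          Measure.lintegral_compProd (by fun_prop)
      _ = ∫⁻ a, klDiv (κ a) (η a) ∂μ := lintegral_congr_ae <| hκη.mono fun a ha => by
          simp only [klDiv_eq_lintegral_klFun_of_ac ha]
          refine lintegral_congr_ae ?_
          filter_upwards [Kernel.rnDeriv_eq_rnDeriv_measure (κ := κ) (η := η)] with b hb
          rw [hb]
  · rw [klDiv_of_not_ac (mt Measure.absolutelyContinuous_compProd_right_iff.1 hκη), eq_comm,
      eq_top_iff]
    have hsing : MeasurableSet {a | κ a ≪ η a}ᶜ :=
      (Kernel.measurableSet_absolutelyContinuous κ η).compl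
    calc ∞ = ∫⁻ _ in {a | κ a ≪ η a}ᶜ, ∞ ∂μ := by
          rw [setLIntegral_const, ENNReal.top_mul (by rwa [ae_iff] at hκη)]
      _ = ∫⁻ a in {a | κ a ≪ η a}ᶜ, klDiv (κ a) (η a) ∂μ :=
          setLIntegral_congr_fun hsing fun a ha => (klDiv_of_not_ac ha).symm
      _ ≤ ∫⁻ a, klDiv (κ a) (η a) ∂μ := setLIntegral_le_lintegral _ _

lemma klDiv_restrict_le (μ ν : Measure α) [IsFiniteMeasure μ] [IsFiniteMeasure ν] {s : Set α}
    (hs : MeasurableSet s) : klDiv (μ.restrict s) (ν.restrict s) ≤ klDiv μ ν := by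
  by_cases h : μ ≪ ν
  swap; · simp only [klDiv_of_not_ac h, le_top]
  have hd : μ.restrict s = (ν.restrict s).withDensity (μ.rnDeriv ν) := by
    rw [← restrict_withDensity hs, Measure.withDensity_rnDeriv_eq _ _ h]
  have hrn : (μ.restrict s).rnDeriv (ν.restrict s) =ᵐ[ν.restrict s] μ.rnDeriv ν := by
    rw [hd]
    exact Measure.rnDeriv_withDensity _ (Measure.measurable_rnDeriv _ _)
  rw [klDiv_eq_lintegral_klFun_of_ac h, klDiv_eq_lintegral_klFun_of_ac (h.restrict s),
    lintegral_congr_ae (hrn.mono fun x hx => by rw [hx])]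
  exact setLIntegral_le_lintegral _ _

lemma ofReal_measureReal_mul_neg_log_sub_one_le_klDiv (μ ν : Measure α) [IsProbabilityMeasure μ]
    [IsFiniteMeasure ν] {s : Set α} (hs : MeasurableSet s) {ε : ℝ} (hν : ν.real s ≤ ε) :
    ENNReal.ofReal (μ.real s * -Real.log ε - 1) ≤ klDiv μ ν := by
  by_cases h : μ ≪ ν
  swap; · simp only [klDiv_of_not_ac h, le_top]
  suffices μ.real s * -Real.log ε - 1
      ≤ μ.real s * Real.log (μ.real s / ν.real s) + ν.real s - μ.real s by
    refine ((ENNReal.ofReal_le_ofReal this).trans ?_).trans (klDiv_restrict_le μ ν hs)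
    simpa only [measureReal_restrict_apply_univ]
      using mul_log_le_klDiv (μ.restrict s) (ν.restrict s)
  have hν0 : 0 ≤ ν.real s := measureReal_nonneg
  rcases (measureReal_nonneg (μ := μ) (s := s)).eq_or_lt with hμ0 | hμ0
  · rw [← hμ0]
    linarith
  have hν1 : 0 < ν.real s := by
    refine hν0.lt_of_ne' fun h0 => hμ0.ne' ?_
    rw [measureReal_eq_zero_iff] at h0 ⊢
    exact h h0
  have hlog : Real.log (ν.real s) ≤ Real.log ε := Real.log_le_log hν1 hν
  have hklFun : 0 ≤ μ.real s * Real.log (μ.real s) + 1 - μ.real s := klFun_nonneg hμ0.le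
  rw [Real.log_div hμ0.ne' hν1.ne']
  linarith [mul_le_mul_of_nonneg_left hlog hμ0.le]

end KullbackLeibler

variable {K : ℕ}

section History

/-- The number of rounds of a history in which an arm of `A` is pulled. -/
def pulls (A : Finset (Fin K)) {t : ℕ} (h : History K t) : ℕ :=
  ({i | (h i).1 ∈ A} : Finset (Fin t)).card

lemma pulls_snoc (A : Finset (Fin K)) {t : ℕ} (h : History K t) (x : Fin K × ℝ) :
    pulls A (Fin.snoc h x : History K (t + 1)) = pulls A h + if x.1 ∈ A then 1 else 0 := by
  simp only [pulls, Finset.card_filter, Fin.sum_univ_castSucc, Fin.snoc_castSucc, Fin.snoc_last]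

lemma pulls_add_pulls_compl (A : Finset (Fin K)) {t : ℕ} (h : History K t) :
    pulls A h + pulls Aᶜ h = t := by
  simpa only [pulls, Finset.mem_compl, Finset.card_univ, Fintype.card_fin]
    using Finset.card_filter_add_card_filter_not (s := Finset.univ) fun i => (h i).1 ∈ A

lemma sum_apply_arm {M : Type*} [NonAssocSemiring M] (f : Fin K → M) {t : ℕ} (h : History K t) :
    ∑ i, f (h i).1 = ∑ k, pulls {k} h * f k := by
  simp only [← Finset.sum_fiberwise' Finset.univ (fun i => (h i).1) f, pulls,
    Finset.mem_singleton, Finset.sum_const, nsmul_eq_mul]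

@[fun_prop]
lemma measurable_pulls (A : Finset (Fin K)) {t : ℕ} :
    Measurable fun h : History K t => pulls A h := by
  simp only [pulls, Finset.card_filter]
  exact Finset.measurable_sum _ fun i _ =>
    (measurable_from_top (f := fun k : Fin K => if k ∈ A then 1 else 0)).comp
      (measurable_pi_apply i).fst

@[fun_prop]
lemma measurable_snoc (t : ℕ) :
    Measurable fun p : History K t × (Fin K × ℝ) => (Fin.snoc p.1 p.2 : History K (t + 1)) := by
  refine measurable_pi_lambda _ (Fin.lastCases ?_ fun i => ?_)
  · simpa only [Fin.snoc_last] using measurable_snd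
  · simpa only [Fin.snoc_castSucc] using measurable_fst.eval

instance (π : Algorithm K) (t : ℕ) : IsMarkovKernel (π.select t) := π.markov t

instance isProbabilityMeasure_historyLaw (π : Algorithm K) (ρ : Kernel (Fin K) ℝ)
    [IsMarkovKernel ρ] : ∀ t, IsProbabilityMeasure (historyLaw π ρ t)
  | 0 => by unfold historyLaw; infer_instance
  | t + 1 => by
      have := isProbabilityMeasure_historyLaw π ρ t
      exact Measure.isProbabilityMeasure_map (measurable_snoc t).aemeasurable

/-- The expected number of pulls of arm `k` in the first `t` rounds, as an extended nonnegative
number so that it can be multiplied with a possibly infinite divergence. -/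
noncomputable def meanPulls (π : Algorithm K) (ρ : Kernel (Fin K) ℝ) (k : Fin K) (t : ℕ) : ℝ≥0∞ :=
  ∫⁻ h, pulls {k} h ∂(historyLaw π ρ t)

variable (π : Algorithm K) (ρ ρ' : Kernel (Fin K) ℝ) [IsMarkovKernel ρ] [IsMarkovKernel ρ']

lemma lintegral_historyLaw_succ {t : ℕ} {f : History K (t + 1) → ℝ≥0∞} (hf : Measurable f) :
    ∫⁻ h, f h ∂(historyLaw π ρ (t + 1))
      = ∫⁻ h, ∫⁻ k, ∫⁻ x, f (Fin.snoc h (k, x)) ∂(ρ k) ∂(π.select t h) ∂(historyLaw π ρ t) := by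
  have hf' : Measurable fun p : History K t × (Fin K × ℝ) => f (Fin.snoc p.1 p.2) :=
    hf.comp (measurable_snoc t)
  rw [historyLaw, lintegral_map hf (measurable_snoc t), Measure.lintegral_compProd hf']
  refine lintegral_congr fun h => ?_
  exact Kernel.lintegral_compProd _ _ _ (hf'.comp measurable_prodMk_left)

lemma meanPulls_succ (k : Fin K) (t : ℕ) :
    meanPulls π ρ k (t + 1)
      = meanPulls π ρ k t + ∫⁻ h, π.select t h {k} ∂(historyLaw π ρ t) := by
  have hstep (h : History K t) :
      ∫⁻ j, ∫⁻ x, (pulls {k} (Fin.snoc h (j, x) : History K (t + 1)) : ℝ≥0∞) ∂(ρ j) ∂(π.select t h)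
        = pulls {k} h + π.select t h {k} := by
    simp only [pulls_snoc, Nat.cast_add, Nat.cast_ite, Nat.cast_one, Nat.cast_zero,
      lintegral_const, measure_univ, mul_one, lintegral_add_left measurable_const]
    rw [← lintegral_indicator_one (measurableSet_singleton k)]
    simp only [Set.indicator, Set.mem_singleton_iff, Finset.mem_singleton, Pi.one_apply]
  rw [meanPulls, lintegral_historyLaw_succ π ρ (by fun_prop)]
  simp only [hstep]
  exact lintegral_add_left (by fun_prop) _

theorem klDiv_historyLaw (t : ℕ) :
    klDiv (historyLaw π ρ t) (historyLaw π ρ' t)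
      = ∑ k, meanPulls π ρ k t * klDiv (ρ k) (ρ' k) := by
  induction t with
  | zero => simp [historyLaw, meanPulls, pulls]
  | succ t ih =>
    have hinv : Function.LeftInverse
        (fun h : History K (t + 1) => (Fin.init h, h (Fin.last t)))
        (fun p : History K t × (Fin K × ℝ) => (Fin.snoc p.1 p.2 : History K (t + 1))) := fun p =>
      Prod.ext (Fin.init_snoc (α := fun _ => Fin K × ℝ) p.2 p.1)
        (Fin.snoc_last (α := fun _ => Fin K × ℝ) p.2 p.1)
    have hround (h : History K t) : klDiv ((π.select t ⊗ₖ ρ.prodMkLeft (History K t)) h)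
        ((π.select t ⊗ₖ ρ'.prodMkLeft (History K t)) h)
          = ∑ k, π.select t h {k} * klDiv (ρ k) (ρ' k) := by
      simp only [Kernel.compProd_apply_eq_compProd_sectR, Kernel.sectR_prodMkLeft,
        klDiv_compProd_right_eq_lintegral, lintegral_fintype, mul_comm]
    have hmeas (k : Fin K) : Measurable fun h => π.select t h {k} :=
      Kernel.measurable_coe _ (measurableSet_singleton k)
    calc klDiv (historyLaw π ρ (t + 1)) (historyLaw π ρ' (t + 1))
        = klDiv (historyLaw π ρ t) (historyLaw π ρ' t)
            + ∫⁻ h, ∑ k, π.select t h {k} * klDiv (ρ k) (ρ' k) ∂(historyLaw π ρ t) := by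
          rw [historyLaw, historyLaw,
            klDiv_map_of_leftInverse (measurable_snoc t) (by unfold Fin.init; fun_prop) hinv,
            klDiv_compProd_eq_add, klDiv_compProd_right_eq_lintegral]
          simp only [hround]
      _ = ∑ k, (meanPulls π ρ k t + ∫⁻ h, π.select t h {k} ∂(historyLaw π ρ t))
            * klDiv (ρ k) (ρ' k) := by
          rw [ih, lintegral_finsetSum _ fun k _ => (hmeas k).mul_const _]
          simp only [lintegral_mul_const _ (hmeas _), add_mul, Finset.sum_add_distrib]
      _ = ∑ k, meanPulls π ρ k (t + 1) * klDiv (ρ k) (ρ' k) := by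
          simp only [meanPulls_succ]

end History

section Regret

variable {Θ : Type*} {ν : Θ → Kernel (Fin K) ℝ}

lemma mean_le_maxMean (θ : Θ) (k : Fin K) : mean ν k θ ≤ maxMean ν θ :=
  le_ciSup (f := fun k => mean ν k θ) (Set.finite_range _).bddAbove k

lemma exists_isOptimal [NeZero K] (θ : Θ) : ∃ k, IsOptimal ν θ k :=
  exists_eq_ciSup_of_finite

lemma isOptimal_iff_eq {θ : Θ} {k : Fin K} (h : ∀ j, j ≠ k → mean ν j θ < mean ν k θ) (j : Fin K) :
    IsOptimal ν θ j ↔ j = k := by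
  have hlt (j : Fin K) (hj : IsOptimal ν θ j) : j = k := by
    by_contra hjk
    exact ((h j hjk).trans_le (mean_le_maxMean θ k)).ne hj
  refine ⟨hlt j, ?_⟩
  rintro rfl
  have : NeZero K := ⟨j.pos.ne'⟩
  obtain ⟨i, hi⟩ := exists_isOptimal (ν := ν) θ
  exact hlt i hi ▸ hi

variable (ν) in
/-- The suboptimality gap `max_ℓ μ_ℓ(θ) - μ_k(θ)`, the expected loss per pull of arm `k`. -/
noncomputable def gap (θ : Θ) (k : Fin K) : ℝ := maxMean ν θ - mean ν k θ

lemma gap_nonneg (θ : Θ) (k : Fin K) : 0 ≤ gap ν θ k := sub_nonneg.2 (mean_le_maxMean θ k)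

lemma gap_pos_iff {θ : Θ} {k : Fin K} : 0 < gap ν θ k ↔ ¬ IsOptimal ν θ k :=
  sub_pos.trans (mean_le_maxMean θ k).lt_iff_ne

lemma ofReal_gap_eq_zero_iff {θ : Θ} {k : Fin K} :
    ENNReal.ofReal (gap ν θ k) = 0 ↔ IsOptimal ν θ k := by
  rw [ENNReal.ofReal_eq_zero, ← not_lt, gap_pos_iff, not_not]

variable (ν) in
/-- The regret accumulated along a history, whose expectation is `regret`. -/
noncomputable def pathRegret (θ : Θ) {t : ℕ} (h : History K t) : ℝ := ∑ i, gap ν θ (h i).1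

lemma pathRegret_nonneg (θ : Θ) {t : ℕ} (h : History K t) : 0 ≤ pathRegret ν θ h :=
  Finset.sum_nonneg fun _ _ => gap_nonneg θ _

lemma mul_pulls_le_pathRegret {θ : Θ} {A : Finset (Fin K)} {δ : ℝ}
    (hA : ∀ k ∈ A, δ ≤ gap ν θ k) {t : ℕ} (h : History K t) :
    δ * pulls A h ≤ pathRegret ν θ h := by
  rw [mul_comm, ← nsmul_eq_mul]
  exact (Finset.card_nsmul_le_sum _ _ δ fun i hi => hA _ (Finset.mem_filter.1 hi).2).trans
    (Finset.sum_le_univ_sum_of_nonneg fun _ => gap_nonneg θ _)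

variable [∀ θ, IsMarkovKernel (ν θ)] (π : Algorithm K)

lemma integrable_pathRegret (θ θ' : Θ) (t : ℕ) :
    Integrable (fun h => pathRegret ν θ h) (historyLaw π (ν θ') t) :=
  integrable_finsetSum _ fun i _ =>
    (Integrable.of_finite (f := gap ν θ)).comp_measurable (measurable_pi_apply i).fst

lemma ofReal_regret (θ : Θ) (T : ℕ) :
    ENNReal.ofReal (regret ν π θ T)
      = ∑ k, meanPulls π (ν θ) k T * ENNReal.ofReal (gap ν θ k) := by
  have hpath (h : History K T) : ENNReal.ofReal (pathRegret ν θ h)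
      = ∑ k, pulls {k} h * ENNReal.ofReal (gap ν θ k) := by
    rw [← sum_apply_arm (fun k => ENNReal.ofReal (gap ν θ k)), pathRegret,
      ENNReal.ofReal_sum_of_nonneg fun _ _ => gap_nonneg θ _]
  calc ENNReal.ofReal (regret ν π θ T)
      = ∫⁻ h, ENNReal.ofReal (pathRegret ν θ h) ∂(historyLaw π (ν θ) T) :=
        ofReal_integral_eq_lintegral_ofReal (integrable_pathRegret (ν := ν) π θ θ T)
          (ae_of_all _ (pathRegret_nonneg θ))
    _ = ∑ k, meanPulls π (ν θ) k T * ENNReal.ofReal (gap ν θ k) := by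
        simp only [hpath, meanPulls]
        rw [lintegral_finsetSum _ fun k _ => by fun_prop]
        exact Finset.sum_congr rfl fun k _ => lintegral_mul_const _ (by fun_prop)

lemma mul_measureReal_le_two_mul_pulls_le {θ : Θ} {A : Finset (Fin K)} {δ : ℝ} (hδ : 0 ≤ δ)
    (hA : ∀ k ∈ A, δ ≤ gap ν θ k) (T : ℕ) :
    δ * T * (historyLaw π (ν θ) T).real {h | T ≤ 2 * pulls A h} ≤ 2 * regret ν π θ T := by
  have hmarkov := mul_meas_ge_le_integral_of_nonneg
    (ae_of_all _ fun h => mul_nonneg zero_le_two (pathRegret_nonneg θ h))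
    ((integrable_pathRegret (ν := ν) π θ θ T).const_mul 2) (δ * T)
  rw [integral_const_mul] at hmarkov
  refine (mul_le_mul_of_nonneg_left (measureReal_mono ?_) (by positivity)).trans hmarkov
  intro h (hT : T ≤ 2 * pulls A h)
  have hT' : (T : ℝ) ≤ 2 * pulls A h := mod_cast hT
  calc δ * T ≤ δ * (2 * pulls A h) := by gcongr
    _ = 2 * (δ * pulls A h) := by ring
    _ ≤ 2 * pathRegret ν θ h := by gcongr; exact mul_pulls_le_pathRegret hA h

end Regret

lemma tendsto_log_natCast_atTop : Tendsto (fun T : ℕ => Real.log T) atTop atTop :=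
  Real.tendsto_log_atTop.comp tendsto_natCast_atTop_atTop

lemma eventually_log_natCast_pos : ∀ᶠ T : ℕ in atTop, 0 < Real.log T :=
  tendsto_log_natCast_atTop.eventually_gt_atTop 0

section LowerBound

variable {Θ : Type*} {ν : Θ → Kernel (Fin K) ℝ} [∀ θ, IsMarkovKernel (ν θ)] {π : Algorithm K}

lemma UniformlyGood.isLittleO_measureReal (hπ : UniformlyGood ν π) {θ : Θ} {A : Finset (Fin K)}
    (hA : ∀ k ∈ A, ¬ IsOptimal ν θ k) {a : ℝ} (ha : 0 < a) :
    (fun T : ℕ => (historyLaw π (ν θ) T).real {h | T ≤ 2 * pulls A h})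
      =o[atTop] fun T : ℕ => (T : ℝ) ^ (a - 1) := by
  obtain ⟨δ, hδ, hδA⟩ := Pi.exists_forall_pos_add_lt (ι := A) (x := 0) (y := fun k => gap ν θ k)
    fun k => gap_pos_iff.2 (hA k k.2)
  have hδA' : ∀ k ∈ A, δ ≤ gap ν θ k := fun k hk => by simpa using (hδA ⟨k, hk⟩).le
  have hbound : (fun T : ℕ => (historyLaw π (ν θ) T).real {h | T ≤ 2 * pulls A h})
      =O[atTop] fun T : ℕ => regret ν π θ T / T := by
    refine .of_bound (2 / δ) ?_
    filter_upwards [eventually_gt_atTop 0] with T hT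
    have hT' : (0 : ℝ) < T := mod_cast hT
    have hmarkov := mul_measureReal_le_two_mul_pulls_le π hδ.le hδA' T
    rw [Real.norm_of_nonneg measureReal_nonneg, norm_div, Real.norm_of_nonneg hT'.le,
      div_mul_div_comm, le_div_iff₀ (by positivity), mul_comm]
    exact hmarkov.trans (by gcongr; exact Real.le_norm_self _)
  refine (hbound.trans_isLittleO ((hπ θ a ha).mul_isBigO
    (isBigO_refl (fun T : ℕ => (T : ℝ)⁻¹) atTop))).congr' .rfl ?_
  filter_upwards [eventually_gt_atTop 0] with T hT
  rw [Real.rpow_sub_one (mod_cast hT.ne'), div_eq_mul_inv]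

lemma UniformlyGood.tendsto_measureReal_one (hπ : UniformlyGood ν π) {θ : Θ} {k : Fin K}
    (hk : ∀ j, j ≠ k → ¬ IsOptimal ν θ j) :
    Tendsto (fun T : ℕ => (historyLaw π (ν θ) T).real {h | T ≤ 2 * pulls {k} h}) atTop (𝓝 1) := by
  have hrare : Tendsto (fun T : ℕ => (historyLaw π (ν θ) T).real {h | T ≤ 2 * pulls {k}ᶜ h})
      atTop (𝓝 0) := by
    simpa using hπ.isLittleO_measureReal (A := {k}ᶜ) (by simpa using hk) one_pos
  refine tendsto_of_tendsto_of_tendsto_of_le_of_le (by simpa using hrare.const_sub 1)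
    tendsto_const_nhds (fun T => ?_) fun T => measureReal_le_one
  have hmeas : MeasurableSet {h : History K T | T ≤ 2 * pulls {k}ᶜ h} :=
    measurableSet_le measurable_const (by fun_prop)
  change 1 - _ ≤ _
  rw [← probReal_compl_eq_one_sub hmeas]
  refine measureReal_mono fun h hh => ?_
  have hsum := pulls_add_pulls_compl {k} h
  simp only [Set.mem_compl_iff, Set.mem_ofPred_eq] at hh ⊢
  lia

lemma UniformlyGood.one_le_liminf_klDiv_div_log (hπ : UniformlyGood ν π) {θ lam : Θ} {k : Fin K}
    (hθ : ∀ j, j ≠ k → ¬ IsOptimal ν θ j) (hlam : ¬ IsOptimal ν lam k) :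
    1 ≤ liminf (fun T : ℕ => klDiv (historyLaw π (ν θ) T) (historyLaw π (ν lam) T)
      / ENNReal.ofReal (Real.log T)) atTop := by
  have hbound (a : ℝ) (ha : 0 < a) : ENNReal.ofReal (1 - a)
      ≤ liminf (fun T : ℕ => klDiv (historyLaw π (ν θ) T) (historyLaw π (ν lam) T)
        / ENNReal.ofReal (Real.log T)) atTop := by
    set p : ℕ → ℝ := fun T => (historyLaw π (ν θ) T).real {h | T ≤ 2 * pulls {k} h}
    have hlim : Tendsto (fun T : ℕ => ENNReal.ofReal (p T * (1 - a) - (Real.log T)⁻¹)) atTop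
        (𝓝 (ENNReal.ofReal (1 - a))) := by
      simpa using ENNReal.tendsto_ofReal (((hπ.tendsto_measureReal_one hθ).mul_const (1 - a)).sub
        (tendsto_inv_atTop_zero.comp tendsto_log_natCast_atTop))
    rw [← hlim.liminf_eq]
    refine liminf_le_liminf ?_
    filter_upwards [(hπ.isLittleO_measureReal (A := {k}) (by simpa using hlam) ha).def one_pos,
      eventually_gt_atTop 0, eventually_log_natCast_pos] with T hrare hT hlog
    have hT' : (0 : ℝ) < T := mod_cast hT
    rw [one_mul, Real.norm_of_nonneg measureReal_nonneg, Real.norm_of_nonneg (by positivity)]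
      at hrare
    rw [ENNReal.le_div_iff_mul_le (.inl (ENNReal.ofReal_pos.2 hlog).ne')
      (.inl ENNReal.ofReal_ne_top), ← ENNReal.ofReal_mul' hlog.le]
    convert ofReal_measureReal_mul_neg_log_sub_one_le_klDiv (historyLaw π (ν θ) T) _
      (measurableSet_le measurable_const (by fun_prop)) hrare using 2
    rw [Real.log_rpow hT']
    field_simp
    ring
  have hone : Tendsto (fun a : ℝ => ENNReal.ofReal (1 - a)) (𝓝[>] 0) (𝓝 1) :=
    ((ENNReal.continuous_ofReal.comp (by fun_prop)).tendsto' _ _ (by simp)).mono_left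
      nhdsWithin_le_nhds
  exact le_of_tendsto hone (eventually_mem_nhdsWithin.mono hbound)

lemma UniformlyGood.exists_asymptotic_rates (hπ : UniformlyGood ν π) {θ : Θ} {k : Fin K}
    (hθ : ∀ j, j ≠ k → ¬ IsOptimal ν θ j) :
    ∃ η : Fin K → ℝ≥0∞,
      ∑ j, η j * ENNReal.ofReal (gap ν θ j)
        = liminf (fun T : ℕ => ENNReal.ofReal (regret ν π θ T / Real.log T)) atTop ∧
      ∀ lam, ¬ IsOptimal ν lam k → (∀ j, klDiv (ν θ j) (ν lam j) ≠ ∞) →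
        1 ≤ ∑ j, η j * klDiv (ν θ j) (ν lam j) := by
  set N : ℕ → Fin K → ℝ≥0∞ := fun T j => meanPulls π (ν θ) j T / ENNReal.ofReal (Real.log T)
  obtain ⟨F, hF, hFlim⟩ := mapClusterPt_iff_ultrafilter.1 <| MapClusterPt.liminf (f := atTop)
    (u := fun T : ℕ => ENNReal.ofReal (regret ν π θ T / Real.log T))
  obtain ⟨η, hη⟩ : ∃ η, Tendsto N F (𝓝 η) := ⟨(F.map N).lim, (F.map N).le_nhds_lim⟩
  have hsum {c : Fin K → ℝ≥0∞} (hc : ∀ j, c j ≠ ∞) :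
      Tendsto (fun T => (∑ j, meanPulls π (ν θ) j T * c j) / ENNReal.ofReal (Real.log T)) F
        (𝓝 (∑ j, η j * c j)) := by
    simp only [div_eq_mul_inv, Finset.sum_mul, mul_right_comm _ (c _)]
    exact tendsto_finsetSum _ fun j _ =>
      ENNReal.Tendsto.mul_const (tendsto_pi_nhds.1 hη j) (.inr (hc j))
  refine ⟨η, tendsto_nhds_unique (hsum fun _ => ENNReal.ofReal_ne_top) (hFlim.congr' ?_),
    fun lam hlam hfin => ?_⟩
  · filter_upwards [hF eventually_log_natCast_pos] with T hlog
    rw [ENNReal.ofReal_div_of_pos hlog, ofReal_regret]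
  · calc 1 ≤ _ := hπ.one_le_liminf_klDiv_div_log hθ hlam
      _ ≤ _ := liminf_le_liminf_of_le hF
      _ = _ := by simpa only [klDiv_historyLaw] using (hsum hfin).liminf_eq

variable {θstar : Θ} {kstar : Fin K}

lemma isFeasible_toNNReal_add {η : Fin K → ℝ≥0∞} {ε : ℝ≥0} (hε : 0 < ε)
    (hparam : ∀ lam ∈ thetaStar ν θstar kstar, ν lam kstar = ν θstar kstar)
    (htop : ∀ k, k ≠ kstar → η k ≠ ∞)
    (hη : ∀ lam ∈ confusing ν θstar kstar, (∀ k, klDiv (ν θstar k) (ν lam k) ≠ ∞) →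
      1 ≤ ∑ k, η k * klDiv (ν θstar k) (ν lam k)) :
    IsFeasible ν θstar kstar fun k => (η k).toNNReal + ε := by
  intro lam hlam
  by_cases hfin : ∀ k, klDiv (ν θstar k) (ν lam k) ≠ ∞
  · refine (hη lam hlam hfin).trans (Finset.sum_le_sum fun k _ => ?_)
    rcases eq_or_ne k kstar with rfl | hk
    · simp only [hparam lam hlam.1, klDiv_self, mul_zero, le_refl]
    · rw [ENNReal.coe_add, ENNReal.coe_toNNReal (htop k hk)]
      gcongr
      exact le_self_add
  · push Not at hfin
    obtain ⟨k, hk⟩ := hfin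
    have htop : (((η k).toNNReal + ε : ℝ≥0) : ℝ≥0∞) * klDiv (ν θstar k) (ν lam k) = ∞ := by
      rw [hk, ENNReal.mul_top (by simp [hε.ne'])]
    rw [ENNReal.sum_eq_top.2 ⟨k, Finset.mem_univ k, htop⟩]
    exact le_top

lemma lowerBoundConst_le_sum_mul_gap {η : Fin K → ℝ≥0∞}
    (huniq : ∀ k, IsOptimal ν θstar k ↔ k = kstar)
    (hparam : ∀ lam ∈ thetaStar ν θstar kstar, ν lam kstar = ν θstar kstar)
    (hη : ∀ lam ∈ confusing ν θstar kstar, (∀ k, klDiv (ν θstar k) (ν lam k) ≠ ∞) →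
      1 ≤ ∑ k, η k * klDiv (ν θstar k) (ν lam k)) :
    lowerBoundConst ν θstar kstar ≤ ∑ k, η k * ENNReal.ofReal (gap ν θstar k) := by
  set g : Fin K → ℝ≥0∞ := fun k => ENNReal.ofReal (gap ν θstar k)
  have hg (k : Fin K) : g k = 0 ↔ k = kstar := ofReal_gap_eq_zero_iff.trans (huniq k)
  rcases eq_or_ne (∑ k, η k * g k) ∞ with hcost | hcost
  · exact hcost ▸ le_top
  have htop (k : Fin K) (hk : k ≠ kstar) : η k ≠ ∞ := fun h =>
    ENNReal.sum_ne_top.1 hcost k (Finset.mem_univ k) (by rw [h, ENNReal.top_mul (mt (hg k).1 hk)])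
  have hperturb (ε : ℝ≥0) (hε : 0 < ε) :
      lowerBoundConst ν θstar kstar ≤ ∑ k, (η k + ε) * g k := by
    refine (iInf₂_le _ (isFeasible_toNNReal_add hε hparam htop hη)).trans
      (Finset.sum_le_sum fun k _ => ?_)
    change _ * g k ≤ _
    gcongr
    exact add_le_add_left ENNReal.coe_toNNReal_le_self _
  have hlim : Tendsto (fun ε : ℝ≥0 => ∑ k, (η k + ε) * g k) (𝓝[>] 0) (𝓝 (∑ k, η k * g k)) := by
    refine tendsto_finsetSum _ fun k _ => ENNReal.Tendsto.mul_const ?_ (.inr ENNReal.ofReal_ne_top)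
    exact ((continuous_const.add ENNReal.continuous_coe).tendsto' _ _ (by simp)).mono_left
      nhdsWithin_le_nhds
  exact ge_of_tendsto hlim (eventually_mem_nhdsWithin.mono hperturb)

theorem UniformlyGood.lowerBoundConst_le_liminf (hπ : UniformlyGood ν π)
    (huniq : ∀ k, IsOptimal ν θstar k ↔ k = kstar)
    (hparam : ∀ lam ∈ thetaStar ν θstar kstar, ν lam kstar = ν θstar kstar) :
    lowerBoundConst ν θstar kstar ≤
      liminf (fun T : ℕ => ENNReal.ofReal (regret ν π θstar T / Real.log T)) atTop := by
  obtain ⟨η, hcost, hη⟩ := hπ.exists_asymptotic_rates fun k => mt (huniq k).1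
  rw [← hcost]
  exact lowerBoundConst_le_sum_mul_gap huniq hparam fun lam hlam => hη lam hlam.2

lemma lowerBoundConst_pos (huniq : ∀ k, IsOptimal ν θstar k ↔ k = kstar)
    (hparam : ∀ lam ∈ thetaStar ν θstar kstar, ν lam kstar = ν θstar kstar) {lam : Θ}
    (hlam : lam ∈ confusing ν θstar kstar) (hfin : ∀ k, klDiv (ν θstar k) (ν lam k) ≠ ∞) :
    0 < lowerBoundConst ν θstar kstar := by
  set g : Fin K → ℝ≥0∞ := fun k => ENNReal.ofReal (gap ν θstar k)
  set D : Fin K → ℝ≥0∞ := fun k => klDiv (ν θstar k) (ν lam k)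
  have hD (k : Fin K) (hk : g k = 0) : D k = 0 := by
    obtain rfl := (huniq k).1 (ofReal_gap_eq_zero_iff.1 hk)
    simp only [D, hparam lam hlam.1, klDiv_self]
  have hM : ∑ k, D k / g k ≠ ∞ := ENNReal.sum_ne_top.2 fun k _ => by
    rcases eq_or_ne (D k) 0 with h | h
    · simp only [h, ENNReal.zero_div, ne_eq, ENNReal.zero_ne_top, not_false_eq_true]
    · exact ENNReal.div_ne_top (hfin k) (mt (hD k) h)
  have hDM (k : Fin K) : D k ≤ (∑ j, D j / g j) * g k := by
    rw [← ENNReal.div_mul_cancel' (hD k) fun h => absurd h ENNReal.ofReal_ne_top]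
    gcongr
    exact Finset.single_le_sum (f := fun j => D j / g j) (fun _ _ => zero_le) (Finset.mem_univ k)
  refine (ENNReal.inv_pos.2 hM).trans_le (le_iInf₂ fun η hη => ?_)
  rw [← one_div]
  refine ENNReal.div_le_of_le_mul' ?_
  calc 1 ≤ ∑ k, η k * D k := hη lam hlam
    _ ≤ ∑ k, η k * ((∑ j, D j / g j) * g k) := by gcongr with k; exact hDM k
    _ = (∑ j, D j / g j) * ∑ k, η k * g k := by
        simp only [Finset.mul_sum, mul_left_comm]

end LowerBound

section Competitive

variable {Θ : Type*} {ν : Θ → Kernel (Fin K) ℝ} {θstar : Θ} {kstar : Fin K}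

lemma numCompetitive_pos (hopt : IsOptimal ν θstar kstar) : 0 < numCompetitive ν θstar kstar :=
  (Set.ncard_pos (Set.toFinite _)).2 ⟨kstar, θstar, rfl, hopt⟩

lemma confusing_eq_empty (hopt : IsOptimal ν θstar kstar)
    (h : numCompetitive ν θstar kstar = 1) : confusing ν θstar kstar = ∅ := by
  obtain ⟨j, hj⟩ := Set.ncard_eq_one.1 h
  have hcomp {lam : Θ} (hlam : lam ∈ thetaStar ν θstar kstar) {i : Fin K}
      (hi : IsOptimal ν lam i) : i = j := hj.subset ⟨lam, hlam, hi⟩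
  refine Set.eq_empty_of_forall_notMem fun lam ⟨hmem, hnot⟩ => hnot ?_
  have : NeZero K := ⟨kstar.pos.ne'⟩
  obtain ⟨i, hi⟩ := exists_isOptimal (ν := ν) lam
  rwa [hcomp rfl hopt, ← hcomp hmem hi]

lemma confusing_nonempty (hshare : ∀ θ ∈ thetaStar ν θstar kstar, IsOptimal ν θ kstar →
      ∀ k, k ≠ kstar → ¬ IsOptimal ν θ k)
    (h : 1 < numCompetitive ν θstar kstar) : (confusing ν θstar kstar).Nonempty := by
  obtain ⟨k, ⟨lam, hlam, hk⟩, hne⟩ := Set.exists_ne_of_one_lt_ncard h kstar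
  exact ⟨lam, hlam, fun hstar => hshare lam hlam hstar k hne hk⟩

lemma lowerBoundConst_eq_zero (h : confusing ν θstar kstar = ∅) :
    lowerBoundConst ν θstar kstar = 0 := by
  refine le_antisymm ((iInf₂_le 0 ?_).trans (by simp)) zero_le
  intro lam hlam
  simp [h] at hlam

lemma liminf_regret_div_log_eq_zero {π : Algorithm K} {θ : Θ} {B : ℝ}
    (hB : ∀ T : ℕ, regret ν π θ T ≤ B) :
    liminf (fun T : ℕ => ENNReal.ofReal (regret ν π θ T / Real.log T)) atTop = 0 := by
  have hlim : Tendsto (fun T : ℕ => ENNReal.ofReal (B / Real.log T)) atTop (𝓝 0) := by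
    simpa using ENNReal.tendsto_ofReal (tendsto_log_natCast_atTop.const_div_atTop B)
  refine (tendsto_of_tendsto_of_tendsto_of_le_of_le tendsto_const_nhds hlim
    (fun _ => zero_le) fun T => ENNReal.ofReal_le_ofReal ?_).liminf_eq
  exact div_le_div_of_nonneg_right (hB T) (Real.log_natCast_nonneg T)

end Competitive

lemma integrable_of_hasSubgaussianMGF_sub_const {Ω : Type*} {mΩ : MeasurableSpace Ω}
    {μ : Measure Ω} [IsFiniteMeasure μ] {X : Ω → ℝ} {m : ℝ} {c : ℝ≥0}
    (h : HasSubgaussianMGF (fun ω => X ω - m) c μ) : Integrable X μ := by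
  refine (integrable_add_iff_integrable_left' (integrable_const (-m))).1 ?_
  simpa only [sub_eq_add_neg] using h.integrable

end StructuredBandit

open StructuredBandit in
theorem proposition1_general {K : ℕ} {Θ : Type*}
    (ν : Θ → Kernel (Fin K) ℝ) [∀ θ, IsMarkovKernel (ν θ)]
    (_ : ∀ θ k, Integrable (fun x : ℝ => x) (ν θ k)) (θstar : Θ) (kstar : Fin K)
    (hparam : ∀ lam ∈ thetaStar ν θstar kstar, ν lam kstar = ν θstar kstar)
    (hopt : ∀ k, k ≠ kstar → mean ν k θstar < mean ν kstar θstar) :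
    (∀ π : Algorithm K, UniformlyGood ν π → lowerBoundConst ν θstar kstar ≤
      liminf (fun T : ℕ => ENNReal.ofReal (regret ν π θstar T / Real.log T)) atTop) ∧
    (numCompetitive ν θstar kstar = 1 → lowerBoundConst ν θstar kstar = 0) ∧
    ((∀ θ ∈ thetaStar ν θstar kstar, IsOptimal ν θ kstar →
        ∀ k, k ≠ kstar → ¬ IsOptimal ν θ k) →
      (∀ θ ∈ thetaStar ν θstar kstar, ∀ k, klDiv (ν θstar k) (ν θ k) ≠ ∞) →
      (1 < numCompetitive ν θstar kstar → 0 < lowerBoundConst ν θstar kstar) ∧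
      ∀ π : Algorithm K, UniformlyGood ν π → (∃ B : ℝ, ∀ T : ℕ, regret ν π θstar T ≤ B) →
        numCompetitive ν θstar kstar = 1) := by
  have huniq := isOptimal_iff_eq hopt
  have hstar : IsOptimal ν θstar kstar := (huniq kstar).2 rfl
  refine ⟨fun π hπ => hπ.lowerBoundConst_le_liminf huniq hparam,
    fun h => lowerBoundConst_eq_zero (confusing_eq_empty hstar h), fun hshare hfin => ?_⟩
  have hpos (h : 1 < numCompetitive ν θstar kstar) : 0 < lowerBoundConst ν θstar kstar := by
    obtain ⟨lam, hlam⟩ := confusing_nonempty hshare h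
    exact lowerBoundConst_pos huniq hparam hlam (hfin lam hlam.1)
  refine ⟨hpos, fun π hπ ⟨B, hB⟩ => le_antisymm (not_lt.1 fun h => ?_) (numCompetitive_pos hstar)⟩
  refine (hpos h).not_ge ?_
  simpa only [liminf_regret_div_log_eq_zero hB] using hπ.lowerBoundConst_le_liminf huniq hparam

theorem proposition1 {K : ℕ} {Θ : Type*}
    (ν : Θ → Kernel (Fin K) ℝ) [∀ θ, IsMarkovKernel (ν θ)]
    -- the rewards are sub-Gaussian with variance proxy `σ ^ 2`
    (σ : ℝ≥0)
    (hsub : ∀ θ k, HasSubgaussianMGF (fun x => x - StructuredBandit.mean ν k θ) (σ ^ 2) (ν θ k))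
    -- the reward law of an arm is parameterized by its mean
    (hparam : ∀ k θ lam,
      StructuredBandit.mean ν k θ = StructuredBandit.mean ν k lam → ν θ k = ν lam k)
    -- `kstar` is the optimal arm under the true parameter `θstar`
    (θstar : Θ) (kstar : Fin K)
    (hopt : ∀ k, k ≠ kstar → StructuredBandit.mean ν k θstar < StructuredBandit.mean ν kstar θstar) :
    (∀ π : StructuredBandit.Algorithm K, StructuredBandit.UniformlyGood ν π →
      StructuredBandit.lowerBoundConst ν θstar kstar ≤
        liminf (fun T : ℕ =>
          ENNReal.ofReal (StructuredBandit.regret ν π θstar T / Real.log T)) atTop) ∧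
    (StructuredBandit.numCompetitive ν θstar kstar = 1 →
      StructuredBandit.lowerBoundConst ν θstar kstar = 0) ∧
    -- positivity, when optimality of `kstar` is never shared on `Θ*` and divergences are finite
    ((∀ θ ∈ StructuredBandit.thetaStar ν θstar kstar, StructuredBandit.IsOptimal ν θ kstar →
        ∀ k, k ≠ kstar → ¬ StructuredBandit.IsOptimal ν θ k) →
      (∀ θ ∈ StructuredBandit.thetaStar ν θstar kstar, ∀ k, klDiv (ν θstar k) (ν θ k) ≠ ∞) →
      (1 < StructuredBandit.numCompetitive ν θstar kstar →
        0 < StructuredBandit.lowerBoundConst ν θstar kstar) ∧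
      ∀ π : StructuredBandit.Algorithm K, StructuredBandit.UniformlyGood ν π →
        (∃ B : ℝ, ∀ T : ℕ, StructuredBandit.regret ν π θstar T ≤ B) →
        StructuredBandit.numCompetitive ν θstar kstar = 1) := by
  exact proposition1_general ν
    (fun θ k => StructuredBandit.integrable_of_hasSubgaussianMGF_sub_const (hsub θ k)) θstar kstar
    (fun lam hlam => hparam kstar lam θstar hlam) hopt
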